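/- Let $M\subseteq B(H)$ be a von Neumann algebra with separable predual acting on a complex Hilbert space $H$, and let $\psi$ be a faithful normal state on $M$. Let $M_0\subseteq M$ be a von Neumann subalgebra (with the same unit), and let $E_{M_0}$ be a $\psi$-preserving conditional expectation from $M$ onto $M_0$ (a positive linear projection of $M$ onto $M_0$ which is an $M_0$-bimodule map and satisfies $\psi\circ E_{M_0}=\psi$). Let $u\in M$ be a unitary in the centralizer $$M^\psi=\{x\in M:\ \psi(xy)=\psi(yx)\ \text{for all } y\in M\}$$ such that 1. $M_0$ and $uM_0u^*$ are $\mathbb C$-independent, that is, $\psi(xy)=\psi(x)\psi(y)$ and $\psi(yx)=\psi(y)\psi(x)$ for all $x\in M_0$, $y\in uM_0u^*$ (equivalently, $\mathbb C\subseteq M_0,\ uM_0u^*\subseteq M$ form a commuting square); 2. the contraction $E_{M_0}(u)$ is normal. Then $E_{M_0}(u)$ has discrete spectrum which can accumulate only at $0$: the eigenvectors of $E_{M_0}(u)$ span a dense subspace of $H$, every nonzero point of the spectrum of $E_{M_0}(u)$ is an eigenvalue, and every accumulation point of the spectrum in $\mathbb C$ equals $0$. -/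

import Mathlib

namespace NCProb

open scoped ComplexOrder InnerProductSpace

variable {H : Type*} [NormedAddCommGroup H] [InnerProductSpace ℂ H] [CompleteSpace H]

/-- The *-algebra of elements of a von Neumann algebra acting on `H`, with the operator norm. -/
abbrev Elem (M : VonNeumannAlgebra H) : Type _ := ↥M.toStarSubalgebra

/-- A bounded functional on a von Neumann algebra `M ⊆ B(H)` is normal (ultraweakly continuous)
if it has the form `x ↦ ∑ₙ ⟪ηₙ, x ξₙ⟫` for square-summable sequences of vectors. -/
def IsNormal {M : VonNeumannAlgebra H} (φ : StrongDual ℂ (Elem M)) : Prop :=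
  ∃ ξ η : ℕ → H, (Summable fun n => ‖ξ n‖ ^ 2) ∧ (Summable fun n => ‖η n‖ ^ 2) ∧
    ∀ x : Elem M, HasSum (fun n => ⟪η n, (x : H →L[ℂ] H) (ξ n)⟫_ℂ) (φ x)

/-- The predual of `M`: the normal functionals, inside the Banach dual with its norm topology. -/
def predual (M : VonNeumannAlgebra H) : Set (StrongDual ℂ (Elem M)) := {φ | IsNormal φ}

/-- A (noncommutative) probability space: a von Neumann algebra with separable predual together
with a faithful normal state. -/
structure IsProbabilitySpace (M : VonNeumannAlgebra H) (ψ : StrongDual ℂ (Elem M)) : Prop where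
  separable_predual : TopologicalSpace.IsSeparable (predual M)
  positive : ∀ x : Elem M, 0 ≤ ψ (star x * x)
  unital : ψ 1 = 1
  faithful : ∀ x : Elem M, ψ (star x * x) = 0 → x = 0
  normal : IsNormal ψ

/-- A von Neumann algebra `M₀`, regarded as a *-subalgebra of `M` (meant for `M₀ ≤ M`). -/
noncomputable def subalgebraOf (M M₀ : VonNeumannAlgebra H) : StarSubalgebra ℂ (Elem M) :=
  M₀.toStarSubalgebra.comap M.toStarSubalgebra.subtype

/-- `E` is a conditional expectation of `M` onto the *-subalgebra `N`: a positive linear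
projection onto `N` which is an `N`-bimodule map. -/
structure IsConditionalExpectation {M : VonNeumannAlgebra H} (N : StarSubalgebra ℂ (Elem M))
    (E : Elem M →ₗ[ℂ] Elem M) : Prop where
  mem : ∀ x, E x ∈ N
  apply_of_mem : ∀ x ∈ N, E x = x
  positive : ∀ x : Elem M, (x : H →L[ℂ] H).IsPositive → (E x : H →L[ℂ] H).IsPositive
  bimodule : ∀ a ∈ N, ∀ b ∈ N, ∀ x, E (a * x * b) = a * E x * b

/-- `E` preserves the state `ψ`. -/
def PreservesState {M : VonNeumannAlgebra H} (ψ : StrongDual ℂ (Elem M))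
    (E : Elem M →ₗ[ℂ] Elem M) : Prop :=
  ∀ x, ψ (E x) = ψ x

/-- The centralizer `M^ψ` of the state `ψ`. -/
def stateCentralizer {M : VonNeumannAlgebra H} (ψ : StrongDual ℂ (Elem M)) : Set (Elem M) :=
  {x | ∀ y, ψ (x * y) = ψ (y * x)}

/-- The `ψ`-preserving conditional expectation of `M` onto the scalars, `x ↦ ψ(x) 1`. -/
noncomputable def scalarExpectation {M : VonNeumannAlgebra H} (ψ : StrongDual ℂ (Elem M)) :
    Elem M →ₗ[ℂ] Elem M :=
  ψ.toLinearMap.smulRight 1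

/-- Independence of `B₁` and `B₂`, both containing the range `N` of the conditional expectation
`E`: `E` factorizes on products in either order. Equivalently, `N ⊆ B₁, B₂ ⊆ M` is a commuting
square. -/
def IsIndependent {M : VonNeumannAlgebra H} (E : Elem M →ₗ[ℂ] Elem M)
    (B₁ B₂ : Set (Elem M)) : Prop :=
  ∀ x ∈ B₁, ∀ y ∈ B₂, E (x * y) = E x * E y ∧ E (y * x) = E y * E x

/-- The conjugate `u N u*` of a set `N` by `u`. -/
def conj {M : VonNeumannAlgebra H} (u : Elem M) (N : Set (Elem M)) : Set (Elem M) :=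
  (fun x => u * x * star u) '' N

/-- A bounded operator has pure point spectrum if its eigenvectors span a dense subspace. -/
def HasPurePointSpectrum (a : H →L[ℂ] H) : Prop :=
  (⨆ z : ℂ, Module.End.eigenspace (a : H →ₗ[ℂ] H) z).topologicalClosure = ⊤

/-- `a` has discrete spectrum that can accumulate only at `0`: the spectrum is pure point, its
nonzero points are eigenvalues, and it has no accumulation point other than `0`. -/
structure HasDiscreteSpectrumAccumulatingOnlyAtZero (a : H →L[ℂ] H) : Prop where
  purePoint : HasPurePointSpectrum a
  eigenvalue : ∀ z ∈ spectrum ℂ a, z ≠ 0 → Module.End.HasEigenvalue (a : H →ₗ[ℂ] H) z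
  accPt : ∀ z : ℂ, AccPt z (Filter.principal (spectrum ℂ a)) → z = 0

end NCProb

/-!
Write `a = E(u)` and `N = M₀`. For `x, y ∈ N` with `y*` in the centralizer of `ψ`, the bimodule
property gives `x a y = E(x u y)`. The map `E` contracts the `2`-norm `ψ(w* w)`, and `u`, `y*` move
cyclically under `ψ`, so independence of `N` and `u N u*` yields the decoupling inequality
`ψ((x a y)* (x a y)) ≤ ψ(x* (x u (y y*) u*)) = ψ(x* x) ψ(y y*)` (`decoupling_inequality`).

The element `a` is itself in the centralizer (`mem_centralizer_of_expectation`), and so is the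
C⋆-algebra it generates. With `x = f(a)` and `y = g(a)` the inequality says, for the distribution
`μ` of the normal element `a` in the state `ψ`,
`∫ |z|² |f|² |g|² dμ ≤ ∫ |f|² dμ · ∫ |g|² dμ`.
If `g = 1` on the support of `f` and both live on `{|z| > δ}`, this forces `∫ |g|² dμ ≥ δ²`, since
`∫ |f|² dμ > 0` by faithfulness whenever `f` does not vanish on the spectrum. Thus every
neighbourhood of a spectral point of modulus greater than `δ` carries mass at least `δ²`
(`exists_le_spectralIntegral`). The total mass being `1`, there are at most `1 / δ²` such points
(`finite_spectrum_norm_ge`). Only continuous functional calculus is used; `μ` appears as the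
functional `spectralIntegral`.

A normal operator whose spectrum is finite away from `0` has discrete spectrum: the nonzero
spectral points are isolated, so their indicator functions are continuous on the spectrum and give
projections onto eigenspaces. The sum `e` of these projections over `{|z| ≥ ε}` satisfies
`‖a (1 - e)‖ ≤ ε`, so `a` kills any vector orthogonal to all of its eigenvectors, and such a vector,
being in the kernel of `a`, vanishes
(`hasPurePointSpectrum_of_finite_norm_ge`).
-/

open scoped ComplexOrder

/-! ### Normal operators whose spectrum is finite away from zero -/

section DiscreteSpectrum

variable {H : Type*} [NormedAddCommGroup H] [InnerProductSpace ℂ H] [CompleteSpace H]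

theorem not_accPt_of_finite_norm_ge {s : Set ℂ}
    (hs : ∀ ε > 0, (s ∩ {z | ε ≤ ‖z‖}).Finite) {z : ℂ} (hz : z ≠ 0) :
    ¬ AccPt z (Filter.principal s) := by
  intro h
  have hz' : 0 < ‖z‖ := norm_pos_iff.mpr hz
  have hU : {w : ℂ | ‖z‖ / 2 ≤ ‖w‖} ∈ nhds z :=
    continuous_norm.continuousAt.preimage_mem_nhds (Ici_mem_nhds (by linarith))
  refine Set.Infinite.of_accPt (h.nhds_inter hU) ?_
  rw [Set.inter_comm]
  exact hs _ (by positivity)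

theorem continuousOn_indicator_singleton_of_not_accPt {s : Set ℂ} {z : ℂ}
    (h : ¬ AccPt z (Filter.principal s)) :
    ContinuousOn (Set.indicator {z} (1 : ℂ → ℂ)) s := by
  intro w _
  by_cases hw : w = z
  · subst hw
    exact continuousWithinAt_of_not_accPt h
  · refine ContinuousAt.continuousWithinAt ?_
    refine (continuousAt_const (y := (0 : ℂ))).congr ?_
    filter_upwards [isOpen_compl_singleton.mem_nhds (show w ∈ ({z} : Set ℂ)ᶜ from hw)] with v hv
    exact (Set.indicator_of_notMem hv _).symm

theorem mul_cfc_indicator_singleton {a : H →L[ℂ] H} [IsStarNormal a] {z : ℂ}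
    (h : ¬ AccPt z (Filter.principal (spectrum ℂ a))) :
    a * cfc (Set.indicator {z} (1 : ℂ → ℂ)) a = z • cfc (Set.indicator {z} (1 : ℂ → ℂ)) a := by
  have hc := continuousOn_indicator_singleton_of_not_accPt h
  conv_lhs => enter [1]; rw [← cfc_id' ℂ a]
  rw [← cfc_mul (fun x => x) _ a continuousOn_id hc, ← cfc_smul z _ a hc]
  refine cfc_congr fun w _ => ?_
  by_cases hw : w = z <;> simp [hw]

/-- At an isolated point `z` of the spectrum, the spectral projection of `{z}` is given by continuous
functional calculus, and it maps into the eigenspace of `z`. -/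
theorem cfc_indicator_singleton_mem_eigenspace {a : H →L[ℂ] H} [IsStarNormal a] {z : ℂ}
    (h : ¬ AccPt z (Filter.principal (spectrum ℂ a))) (v : H) :
    cfc (Set.indicator {z} (1 : ℂ → ℂ)) a v ∈
      Module.End.eigenspace (a : H →ₗ[ℂ] H) z := by
  rw [Module.End.mem_eigenspace_iff]
  exact congrArg (fun b : H →L[ℂ] H => b v) (mul_cfc_indicator_singleton h)

theorem hasEigenvalue_of_not_accPt {a : H →L[ℂ] H} [IsStarNormal a] {z : ℂ}
    (hz : z ∈ spectrum ℂ a) (h : ¬ AccPt z (Filter.principal (spectrum ℂ a))) :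
    Module.End.HasEigenvalue (a : H →ₗ[ℂ] H) z := by
  have hc := continuousOn_indicator_singleton_of_not_accPt h
  have hne : cfc (Set.indicator {z} (1 : ℂ → ℂ)) a ≠ 0 := by
    intro h0
    rw [← cfc_zero ℂ a] at h0
    have := eqOn_of_cfc_eq_cfc h0 (hf := hc) (hg := continuousOn_const)
    simpa using this hz
  obtain ⟨v, hv⟩ : ∃ v, cfc (Set.indicator {z} (1 : ℂ → ℂ)) a v ≠ 0 := by
    by_contra! h0
    exact hne (ContinuousLinearMap.ext h0)
  exact Module.End.hasEigenvalue_of_hasEigenvector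
    ⟨cfc_indicator_singleton_mem_eigenspace h v, hv⟩

theorem isSelfAdjoint_cfc_indicator (s : Set ℂ) (a : H →L[ℂ] H) :
    IsSelfAdjoint (cfc (Set.indicator s (1 : ℂ → ℂ)) a) := by
  rw [IsSelfAdjoint, ← cfc_star]
  refine cfc_congr fun w _ => ?_
  by_cases hw : w ∈ s <;> simp [hw]

/-- A spectral projection at an isolated point is self-adjoint with range in an eigenspace, so it
kills the vectors orthogonal to all eigenspaces. -/
theorem cfc_indicator_apply_eq_zero {a : H →L[ℂ] H} [IsStarNormal a] {z : ℂ}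
    (h : ¬ AccPt z (Filter.principal (spectrum ℂ a))) {v : H}
    (hv : v ∈ (⨆ z : ℂ, Module.End.eigenspace (a : H →ₗ[ℂ] H) z)ᗮ) :
    cfc (Set.indicator {z} (1 : ℂ → ℂ)) a v = 0 := by
  refine ext_inner_left ℂ fun w => ?_
  rw [inner_zero_right, ← ContinuousLinearMap.adjoint_inner_left, ← ContinuousLinearMap.star_eq_adjoint,
    (isSelfAdjoint_cfc_indicator {z} a).star_eq]
  exact (Submodule.mem_orthogonal _ _).mp hv _
    (Submodule.mem_iSup_of_mem z (cfc_indicator_singleton_mem_eigenspace h w))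

theorem hasPurePointSpectrum_of_finite_norm_ge {a : H →L[ℂ] H} [IsStarNormal a]
    (hs : ∀ ε > 0, (spectrum ℂ a ∩ {z | ε ≤ ‖z‖}).Finite) :
    (⨆ z : ℂ, Module.End.eigenspace (a : H →ₗ[ℂ] H) z).topologicalClosure = ⊤ := by
  rw [Submodule.topologicalClosure_eq_top_iff, Submodule.eq_bot_iff]
  intro v hv
  have hle : ∀ ε > 0, ‖a v‖ ≤ ε * ‖v‖ := by
    intro ε hε
    set S := (hs ε hε).toFinset
    have hS' : ∀ z ∈ S, ¬ AccPt z (Filter.principal (spectrum ℂ a)) := fun z hz => by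
      have hz' : z ∈ spectrum ℂ a ∩ {z | ε ≤ ‖z‖} := by simpa [S] using hz
      refine not_accPt_of_finite_norm_ge hs fun h0 => ?_
      have := hz'.2
      simp only [Set.mem_ofPred_eq, h0, norm_zero] at this
      linarith
    have hc : ∀ z ∈ S, ContinuousOn (Set.indicator {z} (1 : ℂ → ℂ)) (spectrum ℂ a) :=
      fun z hz => continuousOn_indicator_singleton_of_not_accPt (hS' z hz)
    -- `e` is the spectral projection of `{|z| ≥ ε}`; it kills `v`, while `‖a (1 - e)‖ ≤ ε`.
    set e : H →L[ℂ] H := cfc (∑ z ∈ S, Set.indicator {z} (1 : ℂ → ℂ)) a with he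
    have hcs : ContinuousOn (∑ z ∈ S, Set.indicator {z} (1 : ℂ → ℂ)) (spectrum ℂ a) := by
      rw [Finset.sum_fn]
      exact continuousOn_finsetSum S hc
    have hev : e v = 0 := by
      rw [he, cfc_sum _ _ _ hc, sum_apply]
      exact Finset.sum_eq_zero fun z hz => cfc_indicator_apply_eq_zero (hS' z hz) hv
    have hmul : a - a * e =
        cfc (fun w => w - w * (∑ z ∈ S, Set.indicator {z} (1 : ℂ → ℂ)) w) a := by
      rw [cfc_sub (fun w => w) (fun w => w * (∑ z ∈ S, Set.indicator {z} (1 : ℂ → ℂ)) w) a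
          continuousOn_id
          (ContinuousOn.mul continuousOn_id hcs),
        cfc_mul (fun w => w) _ a continuousOn_id hcs, cfc_id' ℂ a]
    have hnorm : ‖a - a * e‖ ≤ ε := by
      rw [hmul]
      refine norm_cfc_le hε.le fun w hw => ?_
      rw [Finset.sum_apply]
      by_cases hwS : w ∈ S
      · rw [Finset.sum_eq_single_of_mem w hwS fun z _ hz =>
          Set.indicator_of_notMem (show w ∉ ({z} : Set ℂ) from fun h => hz h.symm) _]
        simpa using hε.le
      · rw [Finset.sum_eq_zero fun z hz =>
          Set.indicator_of_notMem
          (show w ∉ ({z} : Set ℂ) from fun h => hwS ((show w = z from h) ▸ hz)) _]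
        have : ¬ ε ≤ ‖w‖ := fun h => hwS (by simpa [S] using And.intro hw h)
        simpa using (not_le.mp this).le
    calc ‖a v‖ = ‖(a - a * e) v‖ := by
          rw [sub_apply, mul_apply_eq_comp, hev, map_zero,
            sub_zero]
      _ ≤ ‖a - a * e‖ * ‖v‖ := (a - a * e).le_opNorm v
      _ ≤ ε * ‖v‖ := by gcongr
  have hav : a v = 0 := by
    by_contra h0
    have hpos : 0 < ‖a v‖ := norm_pos_iff.mpr h0
    -- `ε * ‖v‖ < ‖a v‖` for this choice of `ε`, also when `‖v‖` is small.
    have := hle (‖a v‖ / (2 * (‖v‖ + 1))) (by positivity)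
    have h2 : ‖a v‖ / (2 * (‖v‖ + 1)) * ‖v‖ < ‖a v‖ := by
      rw [div_mul_eq_mul_div, div_lt_iff₀ (by positivity)]
      nlinarith [norm_nonneg v]
    linarith
  have hmem : v ∈ ⨆ z : ℂ, Module.End.eigenspace (a : H →ₗ[ℂ] H) z :=
    Submodule.mem_iSup_of_mem 0 (by
      rw [Module.End.mem_eigenspace_iff, zero_smul]
      exact hav)
  exact inner_self_eq_zero.mp ((Submodule.mem_orthogonal _ _).mp hv v hmem)

end DiscreteSpectrum

/-! ### Centralizers of positive functionals -/

section State

variable {A : Type*} [CStarAlgebra A] {ψ : StrongDual ℂ A}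

theorem map_star_of_nonneg (hpos : ∀ x : A, 0 ≤ ψ (star x * x)) (x : A) :
    ψ (star x) = star (ψ x) := by
  have h1 := (Complex.nonneg_iff.mp (hpos 1)).2
  have hx := (Complex.nonneg_iff.mp (hpos x)).2
  have h2 := (Complex.nonneg_iff.mp (hpos (1 + x))).2
  have h3 := (Complex.nonneg_iff.mp (hpos (1 + Complex.I • x))).2
  simp only [star_add, star_one, star_smul, add_mul, mul_add, one_mul, mul_one, map_add,
    smul_mul_assoc, mul_smul_comm, map_smul, smul_eq_mul, Complex.add_im, Complex.mul_im,
    Complex.star_def, Complex.conj_I, Complex.neg_re, Complex.neg_im, Complex.I_re, Complex.I_im]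
    at h1 h2 h3 hx
  rw [Complex.mul_re] at h3
  simp only [Complex.neg_re, Complex.neg_im, Complex.I_re, Complex.I_im] at h3
  refine Complex.ext ?_ ?_ <;> simp <;> linarith

/-- The centralizer of a positive functional on a C⋆-algebra, as a ⋆-subalgebra. -/
def centralizerSubalgebra (ψ : StrongDual ℂ A) (hpos : ∀ x : A, 0 ≤ ψ (star x * x)) :
    StarSubalgebra ℂ A where
  carrier := {x | ∀ y, ψ (x * y) = ψ (y * x)}
  mul_mem' {x x'} hx hx' y := by
    rw [mul_assoc, hx, mul_assoc, hx', mul_assoc]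
  add_mem' {x x'} hx hx' y := by
    rw [add_mul, mul_add, map_add, map_add, hx, hx']
  algebraMap_mem' c y := by rw [Algebra.commutes]
  star_mem' {x} hx y := by
    have h := hx (star y)
    have h' := congrArg star h
    rw [← map_star_of_nonneg hpos, ← map_star_of_nonneg hpos] at h'
    simpa using h'.symm

theorem mem_centralizerSubalgebra {hpos : ∀ x : A, 0 ≤ ψ (star x * x)} {x : A} :
    x ∈ centralizerSubalgebra ψ hpos ↔ ∀ y, ψ (x * y) = ψ (y * x) := Iff.rfl

theorem isClosed_centralizerSubalgebra (hpos : ∀ x : A, 0 ≤ ψ (star x * x)) :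
    IsClosed (centralizerSubalgebra ψ hpos : Set A) := by
  have : (centralizerSubalgebra ψ hpos : Set A) = ⋂ y, {x | ψ (x * y) = ψ (y * x)} := by
    ext x
    simp [mem_centralizerSubalgebra]
  rw [this]
  exact isClosed_iInter fun y => isClosed_eq (by fun_prop) (by fun_prop)

/-! ### The decoupling inequality -/

/-- A state-preserving conditional expectation contracts the `2`-norm of the state: `E w` is the
orthogonal projection of `w` in the GNS inner product. -/
theorem expectation_sq_le (hpos : ∀ x : A, 0 ≤ ψ (star x * x)) {N : StarSubalgebra ℂ A}
    {E : A →ₗ[ℂ] A} (hEN : ∀ x, E x ∈ N)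
    (hbimod : ∀ a ∈ N, ∀ b ∈ N, ∀ x, E (a * x * b) = a * E x * b)
    (hEψ : ∀ x, ψ (E x) = ψ x) (w : A) :
    ψ (star (E w) * E w) ≤ ψ (star w * w) := by
  have h1 : ψ (star (E w) * w) = ψ (star (E w) * E w) := by
    have := hbimod (star (E w)) (star_mem (hEN w)) 1 (one_mem N) w
    rw [mul_one, mul_one] at this
    rw [← hEψ, this]
  have h2 : ψ (star w * E w) = ψ (star (E w) * E w) := by
    have h := map_star_of_nonneg hpos (star (E w) * w)
    rw [h1, ← map_star_of_nonneg hpos] at h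
    simpa using h
  have h := hpos (w - E w)
  rw [star_sub, sub_mul, mul_sub, mul_sub, map_sub, map_sub, map_sub, h1, h2, sub_self,
    sub_zero] at h
  exact sub_nonneg.mp h

/-- A state-preserving conditional expectation maps the centralizer of the state into itself. -/
theorem mem_centralizer_of_expectation {N : StarSubalgebra ℂ A}
    {E : A →ₗ[ℂ] A} (hEN : ∀ x, E x ∈ N)
    (hbimod : ∀ a ∈ N, ∀ b ∈ N, ∀ x, E (a * x * b) = a * E x * b)
    (hEψ : ∀ x, ψ (E x) = ψ x) {u : A} (hu : ∀ y, ψ (u * y) = ψ (y * u)) (y : A) :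
    ψ (E u * y) = ψ (y * E u) := by
  have hl : ∀ a ∈ N, ∀ x, E (a * x) = a * E x := fun a ha x => by
    simpa using hbimod a ha 1 (one_mem N) x
  have hr : ∀ b ∈ N, ∀ x, E (x * b) = E x * b := fun b hb x => by
    simpa using hbimod 1 (one_mem N) b hb x
  calc ψ (E u * y) = ψ (u * E y) := by
        rw [← hEψ, hl _ (hEN u), ← hr _ (hEN y), hEψ]
    _ = ψ (E y * u) := hu _
    _ = ψ (y * E u) := by rw [← hEψ, hl _ (hEN y), ← hr _ (hEN u), hEψ]

/-- Independence of `N` and `u N u*` decouples `x` and `y` in the `2`-norm of `x * E u * y`. -/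
theorem decoupling_inequality (hpos : ∀ x : A, 0 ≤ ψ (star x * x)) {N : StarSubalgebra ℂ A}
    {E : A →ₗ[ℂ] A} (hEN : ∀ x, E x ∈ N)
    (hbimod : ∀ a ∈ N, ∀ b ∈ N, ∀ x, E (a * x * b) = a * E x * b)
    (hEψ : ∀ x, ψ (E x) = ψ x) {u : A} (huu : star u * u = 1)
    (hu : ∀ y, ψ (u * y) = ψ (y * u))
    (hind : ∀ b ∈ N, ∀ c ∈ N, ψ (b * (u * c * star u)) = ψ b * ψ (u * c * star u))
    {x y : A} (hx : x ∈ N) (hy : y ∈ N) (hyψ : ∀ z, ψ (star y * z) = ψ (z * star y)) :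
    ψ (star (x * E u * y) * (x * E u * y)) ≤ ψ (star x * x) * ψ (y * star y) := by
  have hustar : ∀ z, ψ (star u * z) = ψ (z * star u) := fun z => by
    have h := congrArg star (hu (star z))
    rw [← map_star_of_nonneg hpos, ← map_star_of_nonneg hpos] at h
    simpa using h.symm
  calc ψ (star (x * E u * y) * (x * E u * y))
      = ψ (star (E (x * u * y)) * E (x * u * y)) := by rw [hbimod x hx y hy]
    _ ≤ ψ (star (x * u * y) * (x * u * y)) := expectation_sq_le hpos hEN hbimod hEψ _
    _ = ψ (star y * (star u * (star x * x * u * y))) := by simp only [star_mul, mul_assoc]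
    _ = ψ (star u * (star x * x * u * y * star y)) := by rw [hyψ]; simp only [mul_assoc]
    _ = ψ (star x * x * (u * (y * star y) * star u)) := by rw [hustar]; simp only [mul_assoc]
    _ = ψ (star x * x) * ψ (u * (y * star y * star u)) := by
        rw [hind _ (mul_mem (star_mem hx) hx) _ (mul_mem hy (star_mem hy)), mul_assoc u]
    _ = ψ (star x * x) * ψ (y * star y) := by rw [hu, mul_assoc _ (star u), huu, mul_one]

/-! ### Spectral mass of a normal element satisfying the decoupling inequality -/

/-- The functional `f ↦ ψ (f(a))` on real functions, that is, integration against the spectral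
distribution of the normal element `a`. It is meaningful for `f` continuous on the spectrum. -/
noncomputable def spectralIntegral (ψ : StrongDual ℂ A) (a : A) (f : ℂ → ℝ) : ℝ :=
  (ψ (cfc (fun z => (f z : ℂ)) a)).re

theorem star_cfc_mul_cfc (a : A) [IsStarNormal a] {f : ℂ → ℂ} (hf : Continuous f) :
    star (cfc f a) * cfc f a = cfc (fun z => ((‖f z‖ ^ 2 : ℝ) : ℂ)) a := by
  rw [← cfc_star, ← cfc_mul (fun z => star (f z)) f a (by fun_prop) (by fun_prop)]
  refine cfc_congr fun z _ => ?_
  simp [Complex.conj_mul']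

theorem spectralIntegral_nonneg (hpos : ∀ x : A, 0 ≤ ψ (star x * x)) (a : A) [IsStarNormal a]
    {f : ℂ → ℝ} (hf : Continuous f) (h0 : ∀ z, 0 ≤ f z) : 0 ≤ spectralIntegral ψ a f := by
  have h := star_cfc_mul_cfc a (f := fun z => ((Real.sqrt (f z) : ℝ) : ℂ)) (by fun_prop)
  have h' := (Complex.nonneg_iff.mp (hpos (cfc (fun z => ((Real.sqrt (f z) : ℝ) : ℂ)) a))).1
  rw [h] at h'
  simpa [spectralIntegral, Real.sq_sqrt (h0 _), ← Complex.ofReal_pow] using h'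

theorem spectralIntegral_mono (hpos : ∀ x : A, 0 ≤ ψ (star x * x)) (a : A) [IsStarNormal a]
    {f g : ℂ → ℝ} (hf : Continuous f) (hg : Continuous g) (h : ∀ z, f z ≤ g z) :
    spectralIntegral ψ a f ≤ spectralIntegral ψ a g := by
  have h' := spectralIntegral_nonneg hpos a (f := fun z => g z - f z) (hg.sub hf) fun z => sub_nonneg.mpr (h z)
  have hs : cfc (fun z => ((g z - f z : ℝ) : ℂ)) a =
      cfc (fun z => (g z : ℂ)) a - cfc (fun z => (f z : ℂ)) a := by
    simp only [Complex.ofReal_sub]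
    exact cfc_sub _ _ a (by fun_prop) (by fun_prop)
  rw [spectralIntegral, hs, map_sub, Complex.sub_re] at h'
  exact sub_nonneg.mp h'

theorem spectralIntegral_const_mul (a : A) [IsStarNormal a] (c : ℝ)
    {f : ℂ → ℝ} (hf : Continuous f) :
    spectralIntegral ψ a (fun z => c * f z) = c * spectralIntegral ψ a f := by
  simp only [spectralIntegral, Complex.ofReal_mul]
  rw [cfc_const_mul _ _ a (by fun_prop), map_smul, smul_eq_mul, Complex.re_ofReal_mul]

theorem spectralIntegral_sum (a : A) [IsStarNormal a] {ι : Type*} (t : Finset ι)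
    {f : ι → ℂ → ℝ} (hf : ∀ i, Continuous (f i)) :
    spectralIntegral ψ a (fun z => ∑ i ∈ t, f i z) = ∑ i ∈ t, spectralIntegral ψ a (f i) := by
  simp only [spectralIntegral, Complex.ofReal_sum]
  rw [← Complex.re_sum, ← map_sum, ← cfc_sum _ a t fun i _ => by have := hf i; fun_prop]
  congr! 3
  ext z
  simp

theorem spectralIntegral_one (hone : ψ 1 = 1) (a : A) [IsStarNormal a] :
    spectralIntegral ψ a (fun _ => 1) = 1 := by
  simp only [spectralIntegral, Complex.ofReal_one]
  rw [cfc_const_one ℂ a, hone, Complex.one_re]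

/-- Under the decoupling inequality, every neighbourhood of a spectral point of modulus greater
than `δ` carries spectral mass at least `δ ^ 2`, in the form of a bump function. -/
theorem exists_le_spectralIntegral (hpos : ∀ x : A, 0 ≤ ψ (star x * x))
    (hfaithful : ∀ x : A, ψ (star x * x) = 0 → x = 0) {a : A} [IsStarNormal a]
    (hdec : ∀ x ∈ StarAlgebra.elemental ℂ a, ∀ y ∈ StarAlgebra.elemental ℂ a,
      ψ (star (x * a * y) * (x * a * y)) ≤ ψ (star x * x) * ψ (y * star y))
    {δ : ℝ} (hδ : 0 < δ) {z₀ : ℂ} (hz₀ : z₀ ∈ spectrum ℂ a) (hδz₀ : δ < ‖z₀‖)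
    {U : Set ℂ} (hU : IsOpen U) (hz₀U : z₀ ∈ U) :
    ∃ h : ℂ → ℝ, Continuous h ∧ (∀ z, 0 ≤ h z) ∧ (∀ z, h z ≤ 1) ∧ (∀ z ∉ U, h z = 0) ∧
      δ ^ 2 ≤ spectralIntegral ψ a h := by
  obtain ⟨r, hr, hrU⟩ := Metric.isOpen_iff.mp
    (hU.inter (isOpen_lt continuous_const continuous_norm : IsOpen {z : ℂ | δ < ‖z‖}))
    z₀ ⟨hz₀U, hδz₀⟩
  -- `g` equals `1` on the support of `f`, so that `f * g = f`.
  set f : ℂ → ℝ := fun z => max 0 (1 - 2 * dist z z₀ / r) with hf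
  set g : ℂ → ℝ := fun z => max 0 (min 1 (2 - 2 * dist z z₀ / r)) with hg
  have hfc : Continuous f := by fun_prop
  have hgc : Continuous g := by fun_prop
  have hg0 : ∀ z, 0 ≤ g z := fun z => le_max_left _ _
  have hg1 : ∀ z, g z ≤ 1 := fun z => max_le zero_le_one (min_le_left _ _)
  have hgU : ∀ z, dist z z₀ ≥ r → g z = 0 := fun z hz => by
    have : 2 ≤ 2 * dist z z₀ / r := by rw [le_div_iff₀ hr]; linarith
    exact max_eq_left ((min_le_right _ _).trans (by linarith))
  have hfg : ∀ z, f z * g z = f z := fun z => by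
    by_cases h : 1 ≤ 2 * dist z z₀ / r
    · rw [show f z = 0 from max_eq_left (by linarith), zero_mul]
    · rw [show g z = 1 from ?_, mul_one]
      simp only [hg]
      rw [min_eq_left (by linarith), max_eq_right zero_le_one]
  -- `f` is supported where `δ < ‖z‖`.
  have hfδ : ∀ z, δ ^ 2 * f z ^ 2 ≤ ‖z‖ ^ 2 * f z ^ 2 := fun z => by
    by_cases h : dist z z₀ < r
    · have : δ < ‖z‖ := (hrU h).2
      gcongr
    · rw [show f z = 0 by rw [← hfg, hgU z (not_lt.mp h), mul_zero]]
      simp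
  set x : A := cfc (fun z => (f z : ℂ)) a with hx
  set y : A := cfc (fun z => (g z : ℂ)) a with hy
  have hxx : star x * x = cfc (fun z => ((f z ^ 2 : ℝ) : ℂ)) a := by
    rw [hx, star_cfc_mul_cfc a (by fun_prop)]
    simp
  have hyy : y * star y = cfc (fun z => ((g z ^ 2 : ℝ) : ℂ)) a := by
    have : star y = y := by
      rw [hy, ← cfc_star]
      simp
    rw [this]
    nth_rewrite 1 [← this]
    rw [hy, star_cfc_mul_cfc a (by fun_prop)]
    simp
  have hxay : x * a * y = cfc (fun z => f z * z) a := by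
    conv_lhs => enter [1, 2]; rw [← cfc_id' ℂ a]
    rw [hx, hy, ← cfc_mul _ _ a (by fun_prop) (by fun_prop),
      ← cfc_mul _ _ a (by fun_prop) (by fun_prop)]
    refine cfc_congr fun z _ => ?_
    rw [mul_right_comm, ← Complex.ofReal_mul, hfg]
  have hlhs : star (x * a * y) * (x * a * y) =
      cfc (fun z => ((‖z‖ ^ 2 * f z ^ 2 : ℝ) : ℂ)) a := by
    rw [hxay, star_cfc_mul_cfc a (by fun_prop)]
    refine cfc_congr fun z _ => ?_
    simp [mul_pow, mul_comm]
  have hx0 : x ≠ 0 := by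
    intro h0
    rw [hx, ← cfc_zero ℂ a] at h0
    have := eqOn_of_cfc_eq_cfc h0 (hf := by fun_prop) (hg := continuousOn_const)
    simpa [hf] using this hz₀
  have hkey := hdec x (cfc_mem_elemental _ a) y (cfc_mem_elemental _ a)
  have hmono := spectralIntegral_mono hpos a (f := fun z => δ ^ 2 * f z ^ 2)
    (g := fun z => ‖z‖ ^ 2 * f z ^ 2) (by fun_prop) (by fun_prop) hfδ
  rw [spectralIntegral_const_mul a _ (by fun_prop)] at hmono
  have hX := Complex.nonneg_iff.mp (hpos x)
  have hXpos : 0 < (ψ (star x * x)).re := by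
    refine lt_of_le_of_ne hX.1 fun h => hx0 (hfaithful x (Complex.ext h.symm hX.2.symm))
  have hkey' := (Complex.le_def.mp hkey).1
  rw [Complex.mul_re, ← hX.2, zero_mul, sub_zero, hlhs, hyy] at hkey'
  refine ⟨fun z => g z ^ 2, by fun_prop, fun z => sq_nonneg _,
    fun z => pow_le_one₀ (hg0 z) (hg1 z), fun z hz => ?_, ?_⟩
  · have : r ≤ dist z z₀ := not_lt.mp fun h => hz (hrU h).1
    simp [hgU z this]
  · unfold spectralIntegral at hmono ⊢
    rw [← hxx] at hmono
    exact le_of_mul_le_mul_right ((hmono.trans hkey').trans_eq (mul_comm _ _)) hXpos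

/-- Points of the spectrum of modulus at least `ε` have disjoint neighbourhoods of mass at least
`(ε / 2) ^ 2` each, out of a total mass of `1`, so there are only finitely many of them. -/
theorem finite_spectrum_norm_ge (hpos : ∀ x : A, 0 ≤ ψ (star x * x)) (hone : ψ 1 = 1)
    (hfaithful : ∀ x : A, ψ (star x * x) = 0 → x = 0) {a : A} [IsStarNormal a]
    (hdec : ∀ x ∈ StarAlgebra.elemental ℂ a, ∀ y ∈ StarAlgebra.elemental ℂ a,
      ψ (star (x * a * y) * (x * a * y)) ≤ ψ (star x * x) * ψ (y * star y))
    {ε : ℝ} (hε : 0 < ε) : (spectrum ℂ a ∩ {z | ε ≤ ‖z‖}).Finite := by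
  by_contra hinf
  obtain ⟨n, hn⟩ := exists_nat_gt (1 / (ε / 2) ^ 2)
  obtain ⟨t, hts, rfl⟩ := Set.Infinite.exists_subset_card_eq hinf n
  obtain ⟨U, hU, hdisj⟩ := t.finite_toSet.t2_separation
  have hex : ∀ z : ℂ, ∃ h : ℂ → ℝ, Continuous h ∧ (∀ w, 0 ≤ h w) ∧ (∀ w, h w ≤ 1) ∧
      (∀ w ∉ U z, h w = 0) ∧ (z ∈ t → (ε / 2) ^ 2 ≤ spectralIntegral ψ a h) := by
    intro z
    by_cases hz : z ∈ t
    · have hz' := hts hz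
      have hlt : ε / 2 < ‖z‖ := (half_lt_self hε).trans_le hz'.2
      obtain ⟨h, h1, h2, h3, h4, h5⟩ := exists_le_spectralIntegral hpos hfaithful hdec
        (half_pos hε) hz'.1 hlt (hU z).2 (hU z).1
      exact ⟨h, h1, h2, h3, h4, fun _ => h5⟩
    · exact ⟨fun _ => 0, continuous_const, fun _ => le_rfl, fun _ => zero_le_one,
        fun _ _ => rfl, fun h => absurd h hz⟩
  choose h hc h0 h1 hout hmass using hex
  have hsum : ∀ w, ∑ z ∈ t, h z w ≤ 1 := by
    intro w
    by_cases hw : ∃ z ∈ t, w ∈ U z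
    · obtain ⟨z, hz, hwz⟩ := hw
      rw [Finset.sum_eq_single_of_mem z hz fun z' hz' hne => hout z' w fun hwz' =>
        Set.disjoint_left.mp (hdisj hz' hz hne) hwz' hwz]
      exact h1 z w
    · push Not at hw
      rw [Finset.sum_eq_zero fun z hz => hout z w (hw z hz)]
      exact zero_le_one
  have hle : ∑ z ∈ t, spectralIntegral ψ a (h z) ≤ 1 := by
    rw [← spectralIntegral_sum a t hc, ← spectralIntegral_one hone a]
    exact spectralIntegral_mono hpos a (continuous_finsetSum _ fun z _ => hc z)
      continuous_const hsum
  have hcard : (t.card : ℝ) * (ε / 2) ^ 2 ≤ 1 := by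
    rw [← nsmul_eq_mul]
    exact (Finset.card_nsmul_le_sum t _ _ hmass).trans hle
  rw [div_lt_iff₀ (by positivity)] at hn
  linarith

end State

/-! ### The conditional expectation of an independent unitary -/

theorem VonNeumannAlgebra.isClosed_coe {H : Type*} [NormedAddCommGroup H] [InnerProductSpace ℂ H]
    [CompleteSpace H] (M : VonNeumannAlgebra H) :
    IsClosed (M.toStarSubalgebra : Set (H →L[ℂ] H)) := by
  rw [VonNeumannAlgebra.coe_toStarSubalgebra, ← M.centralizer_centralizer]
  exact Set.isClosed_centralizer _

theorem mainTheorem6 {H : Type*} [NormedAddCommGroup H] [InnerProductSpace ℂ H] [CompleteSpace H]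
    (M M₀ : VonNeumannAlgebra H) (ψ : StrongDual ℂ (NCProb.Elem M))
    (hψ : NCProb.IsProbabilitySpace M ψ)
    (hM₀ : M₀ ≤ M)
    (E : NCProb.Elem M →ₗ[ℂ] NCProb.Elem M)
    (hE : NCProb.IsConditionalExpectation (NCProb.subalgebraOf M M₀) E)
    (hEψ : NCProb.PreservesState ψ E)
    (u : NCProb.Elem M) (hu : u ∈ unitary (NCProb.Elem M))
    (huψ : u ∈ NCProb.stateCentralizer ψ)
    (hind : NCProb.IsIndependent (NCProb.scalarExpectation ψ)
      (NCProb.subalgebraOf M M₀ : Set (NCProb.Elem M))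
      (NCProb.conj u (NCProb.subalgebraOf M M₀ : Set (NCProb.Elem M))))
    (hnormal : IsStarNormal (E u)) :
    NCProb.HasDiscreteSpectrumAccumulatingOnlyAtZero ((E u : NCProb.Elem M) : H →L[ℂ] H) := by
  have hMcl : IsClosed (M.toStarSubalgebra : Set (H →L[ℂ] H)) := M.isClosed_coe
  set N := NCProb.subalgebraOf M M₀
  have hNcl : IsClosed (N : Set (NCProb.Elem M)) :=
    M₀.isClosed_coe.preimage continuous_subtype_val
  have hpos := hψ.positive
  have huu : star u * u = 1 := (Unitary.mem_iff.mp hu).1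
  have hind' : ∀ b ∈ N, ∀ c ∈ N, ψ (b * (u * c * star u)) = ψ b * ψ (u * c * star u) := by
    intro b hb c hc
    have h := congrArg ψ (hind b hb (u * c * star u) ⟨c, hc, rfl⟩).1
    simpa [NCProb.scalarExpectation, hψ.unital, mul_comm] using h
  -- The C⋆-algebra generated by `E u` stays inside `M₀` and inside the centralizer of `ψ`.
  have helN : StarAlgebra.elemental ℂ (E u) ≤ N :=
    StarAlgebra.elemental.le_of_mem hNcl (hE.mem u)
  have helψ : StarAlgebra.elemental ℂ (E u) ≤ centralizerSubalgebra ψ hpos :=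
    StarAlgebra.elemental.le_of_mem (isClosed_centralizerSubalgebra hpos)
      (mem_centralizer_of_expectation hE.mem hE.bimodule hEψ huψ)
  have hdec : ∀ x ∈ StarAlgebra.elemental ℂ (E u), ∀ y ∈ StarAlgebra.elemental ℂ (E u),
      ψ (star (x * E u * y) * (x * E u * y)) ≤ ψ (star x * x) * ψ (y * star y) :=
    fun x hx y hy => decoupling_inequality hpos hE.mem hE.bimodule hEψ huu huψ hind'
      (helN hx) (helN hy) (helψ (star_mem hy))
  have hfin : ∀ ε > 0, (spectrum ℂ (E u : H →L[ℂ] H) ∩ {z | ε ≤ ‖z‖}).Finite := fun ε hε => by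
    rw [← StarSubalgebra.spectrum_eq M.toStarSubalgebra (hS := hMcl)]
    exact finite_spectrum_norm_ge hpos hψ.unital hψ.faithful hdec hε
  have hnormal' : IsStarNormal (E u : H →L[ℂ] H) :=
    ⟨congrArg (Subtype.val : NCProb.Elem M → (H →L[ℂ] H)) hnormal.star_comm_self⟩
  refine ⟨hasPurePointSpectrum_of_finite_norm_ge hfin, fun z hz hz0 =>
    hasEigenvalue_of_not_accPt hz (not_accPt_of_finite_norm_ge hfin hz0), fun z hz => ?_⟩
  by_contra hz0
  exact not_accPt_of_finite_norm_ge hfin hz0 hz
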